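/- For a set $X$ and a family $\mathcal I$ of subsets of $X$ let $\mathrm{cov}(\mathcal I)=\min\{|\mathcal A| : \mathcal A\subseteq\mathcal I,\ \bigcup\mathcal A=X\}$, and let $\mathcal N_{\omega_1}$ be the ideal of null sets of the standard (fair coin) product measure on $2^{\omega_1}$. Assume $\mathrm{cov}(\mathcal N_{\omega_1})>\omega_1$. Let $K$ be a compact Hausdorff space that supports a measure, i.e. there is a finite Borel measure $\mu$ on $K$, inner regular with respect to compact sets, such that $\mu(U)>0$ for every nonempty open $U\subseteq K$. Suppose that the $\pi$-weight of $K$ is at most $\omega_1$, where the $\pi$-weight is the least cardinality of a $\pi$-base, i.e. of a family $\mathcal P$ of nonempty open subsets of $K$ such that every nonempty open $V\subseteq K$ contains some $U\in\mathcal P$. Then $K$ is separable. -/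

import Mathlib

open MeasureTheory Cardinal

/-- The ideal of `μ`-null sets, i.e. of all sets of outer measure zero: the sets that are contained
in a measurable set of measure zero. -/
def nullIdeal {X : Type*} [MeasurableSpace X] (μ : Measure X) : Set (Set X) :=
  {A | μ A = 0}

/-- The covering number of a family `I` of subsets of `X`: the least cardinality of a subfamily
of `I` whose union is all of `X`. -/
noncomputable def coveringNumber {X : Type*} (I : Set (Set X)) : Cardinal :=
  sInf {κ | ∃ A : Set (Set X), A ⊆ I ∧ ⋃₀ A = Set.univ ∧ #A = κ}

/-- The fair coin measure on the two-point space: each point has measure `1 / 2`. -/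
noncomputable def coinMeasure : Measure Bool :=
  (PMF.uniformOfFintype Bool).toMeasure

instance instIsProbabilityMeasureCoinMeasure : IsProbabilityMeasure coinMeasure := by
  unfold coinMeasure
  infer_instance

/-- The standard product measure on `2^ι`, the product of fair coin measures. It is defined on the
product `σ`-algebra; by Kakutani's theorem every Borel set lies in the completion of the product
`σ`-algebra, so the null sets are those of the Borel (Radon) product measure. -/
noncomputable def cantorMeasure (ι : Type*) : Measure (ι → Bool) :=
  Measure.infinitePi fun _ : ι => coinMeasure

/-- `𝒩_κ`, the ideal of null sets of `2^κ`, where `κ` is represented by a set of cardinality `κ`. -/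
noncomputable def cantorNullIdeal (κ : Cardinal) : Set (Set (κ.out → Bool)) :=
  nullIdeal (cantorMeasure κ.out)

/-- A `π`-base of a space: a family of nonempty open sets such that every nonempty open set
contains a member of the family. -/
structure IsPiBase {K : Type*} [TopologicalSpace K] (P : Set (Set K)) : Prop where
  isOpen : ∀ U ∈ P, IsOpen U
  nonempty : ∀ U ∈ P, U.Nonempty
  exists_subset : ∀ V : Set K, IsOpen V → V.Nonempty → ∃ U ∈ P, U ⊆ V

/-- The `π`-weight of a space: the least cardinality of a `π`-base. -/
noncomputable def piWeight (K : Type*) [TopologicalSpace K] : Cardinal :=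
  sInf {κ | ∃ P : Set (Set K), IsPiBase P ∧ #P = κ}

/-- `K` supports a measure: there is a finite Borel measure on `K` that is inner regular with
respect to compact sets and strictly positive on nonempty open sets. -/
def SupportsMeasure (K : Type*) [TopologicalSpace K] : Prop :=
  ∃ (_ : MeasurableSpace K) (_ : BorelSpace K) (μ : Measure K),
    IsFiniteMeasure μ ∧ μ.InnerRegular ∧ μ.IsOpenPosMeasure

/-! Shrink the members of a `π`-base of size at most `ℵ₁` to closed sets `b i` of positive measure;
a sequence of points that enters every `b i` has dense range. A `μ`-random sequence enters each
fixed `b i` almost surely, but `ℵ₁` many null sets must be avoided at once, and the hypothesis on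
`cov` concerns coin tosses, not points of `K`. So only the membership pattern of the random sequence
is simulated. Its law on `2^(ℕ × ι)` is the image of the coin measure on `2^ι` under a measurable
`Ψ` (`exists_map_cantorMeasure_eq`): the entries are sampled along a well-order, each with its
conditional probability given the earlier ones. Almost every pattern enters a given `b i` and never
demands that finitely many `b i` with empty intersection share a point. These are `ℵ₁` many
conditions, so some pattern satisfies them all, and compactness realizes it by points
(`exists_seq_forall_exists_mem`). -/

open scoped ENNReal

/-! ### Sampling Boolean families along a well-order. -/

section SequentialSampling

variable {κ T : Type*} [LinearOrder κ]

/-- The Boolean family that agrees with `y` strictly below `i` and is `false` elsewhere. -/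
def truncBelow (i : κ) (y : κ → Bool) : κ → Bool := fun j => if j < i then y j else false

theorem truncBelow_congr {i : κ} {y z : κ → Bool} (h : ∀ j < i, y j = z j) :
    truncBelow i y = truncBelow i z := by
  funext j
  by_cases hj : j < i <;> simp [truncBelow, hj, h]

theorem measurable_truncBelow (i : κ) : Measurable (truncBelow i) := by
  refine measurable_pi_lambda _ fun j => ?_
  by_cases hj : j < i
  · simpa [truncBelow, hj] using measurable_pi_apply j
  · simp [truncBelow, hj]

/-- A finite set of coordinates with greatest element `i` behaves under truncation at `i`. -/
theorem forall_mem_iff_truncBelow {F : Finset κ} {i : κ} (hi : i ∈ F) (hmax : ∀ j ∈ F, j ≤ i)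
    (y : κ → Bool) :
    (∀ j ∈ F, y j = true) ↔
      truncBelow i y ∈ {z : κ → Bool | ∀ j ∈ F.erase i, z j = true} ∧ y i = true := by
  simp only [Set.mem_ofPred_eq, Finset.mem_erase, truncBelow]
  constructor
  · intro h
    refine ⟨fun j hj => ?_, h i hi⟩
    rw [if_pos (lt_of_le_of_ne (hmax j hj.2) hj.1)]
    exact h j hj.2
  · rintro ⟨h, h'⟩ j hj
    rcases eq_or_ne j i with rfl | hji
    · exact h'
    · have := h j ⟨hji, hj⟩
      rwa [if_pos (lt_of_le_of_ne (hmax j hj) hji)] at this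

variable [WellFoundedLT κ]

open Classical in
/-- The Boolean family whose `i`-th entry is sampled from the source `ω i` with a probability
`p i` that depends on the entries below `i`; the source `t` yields `true` with parameter `q`
when `(q, t) ∈ D`. -/
noncomputable def sequentialSample (p : κ → (κ → Bool) → ℝ≥0∞) (D : Set (ℝ≥0∞ × T))
    (ω : κ → T) : κ → Bool :=
  (wellFounded_lt (α := κ)).fix fun i rec =>
    decide ((p i (fun j => if h : j < i then rec j h else false), ω i) ∈ D)

variable {p : κ → (κ → Bool) → ℝ≥0∞} {D : Set (ℝ≥0∞ × T)}

open Classical in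
theorem sequentialSample_eq_true_iff (ω : κ → T) (i : κ) :
    sequentialSample p D ω i = true ↔
      (p i (truncBelow i (sequentialSample p D ω)), ω i) ∈ D := by
  rw [sequentialSample, WellFounded.fix_eq, decide_eq_true_iff]
  rfl

/-- Entry `j` consults only the sources at indices up to `j`; this is the origin of the independence
of `ω i` from the entries below `i`. -/
theorem sequentialSample_update (ω : κ → T) (i : κ) (t : T) (j : κ) (hj : j < i) :
    sequentialSample p D (Function.update ω i t) j = sequentialSample p D ω j := by
  induction j using WellFoundedLT.induction with
  | ind j ih =>
    rw [Bool.eq_iff_iff, sequentialSample_eq_true_iff, sequentialSample_eq_true_iff, Function.update_of_ne hj.ne,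
      truncBelow_congr fun k hk => ih k hk (hk.trans hj)]

theorem measurable_sequentialSample [MeasurableSpace T] (hp : ∀ i, Measurable (p i))
    (hD : MeasurableSet D) : Measurable (sequentialSample p D) := by
  classical
  refine measurable_pi_lambda _ fun i => ?_
  induction i using WellFoundedLT.induction with
  | ind i ih =>
    have h : Measurable fun ω => truncBelow i (sequentialSample p D ω) := by
      refine measurable_pi_lambda _ fun j => ?_
      by_cases hj : j < i
      · simpa [truncBelow, hj] using ih j hj
      · simp [truncBelow, hj]
    refine measurable_to_bool ?_
    have : (fun ω => sequentialSample p D ω i) ⁻¹' {true} =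
        (fun ω => (p i (truncBelow i (sequentialSample p D ω)), ω i)) ⁻¹' D := by
      ext ω
      simp [sequentialSample_eq_true_iff]
    rw [this]
    exact (((hp i).comp h).prodMk (measurable_pi_apply i)) hD

end SequentialSampling

/-! ### Laws on `2^κ` as images of product measures. -/

section Laws

theorem measurableSet_forall_mem_eq_true {κ : Type*} (F : Finset κ) :
    MeasurableSet {y : κ → Bool | ∀ j ∈ F, y j = true} := by
  have : {y : κ → Bool | ∀ j ∈ F, y j = true} = ⋂ j ∈ F, (fun y : κ → Bool => y j) ⁻¹' {true} := by
    ext y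
    simp
  rw [this]
  exact F.measurableSet_biInter fun j _ => measurable_pi_apply j (measurableSet_singleton true)

/-- A finite measure on `2^κ` is determined by the measures of the positive cylinders. -/
theorem measure_bool_pi_ext {κ : Type*} {μ ν : Measure (κ → Bool)} [IsFiniteMeasure μ]
    (h : ∀ F : Finset κ, μ {y | ∀ j ∈ F, y j = true} = ν {y | ∀ j ∈ F, y j = true}) : μ = ν := by
  classical
  refine ext_of_generate_finite
    (Set.range fun F : Finset κ => {y : κ → Bool | ∀ j ∈ F, y j = true}) ?_ ?_ ?_ ?_
  · apply le_antisymm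
    · refine iSup_le fun j => ?_
      rw [← measurable_iff_comap_le]
      refine measurable_to_bool (MeasurableSpace.measurableSet_generateFrom ⟨{j}, ?_⟩)
      ext y
      simp
    · refine MeasurableSpace.generateFrom_le ?_
      rintro _ ⟨F, rfl⟩
      exact measurableSet_forall_mem_eq_true F
  · rintro _ ⟨F, rfl⟩ _ ⟨G, rfl⟩ _
    refine ⟨F ∪ G, ?_⟩
    ext y
    simp [or_imp, forall_and]
  · rintro _ ⟨F, rfl⟩
    exact h F
  · simpa using h ∅

theorem measurable_update_prod {κ : Type*} {T : κ → Type*} [DecidableEq κ]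
    [∀ i, MeasurableSpace (T i)] (i : κ) :
    Measurable fun x : (∀ j, T j) × T i => Function.update x.1 i x.2 :=
  measurable_pi_lambda _ fun j => by
    by_cases hj : j = i
    · subst hj
      simpa using measurable_snd
    · simp only [Function.update_of_ne hj]
      fun_prop

/-- Resampling one coordinate independently preserves a product measure: on a box, the fresh value
supplies exactly the factor at `i`. -/
theorem infinitePi_map_update {κ : Type*} {T : κ → Type*} [DecidableEq κ]
    [∀ i, MeasurableSpace (T i)] (τ : ∀ i, Measure (T i)) [∀ i, IsProbabilityMeasure (τ i)]
    (i : κ) :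
    ((Measure.infinitePi τ).prod (τ i)).map (fun x => Function.update x.1 i x.2) =
      Measure.infinitePi τ := by
  have hm := measurable_update_prod (T := T) i
  refine Measure.eq_infinitePi _ fun s t ht => ?_
  rw [Measure.map_apply hm (.pi s.countable_toSet fun _ _ => ht _)]
  by_cases hi : i ∈ s
  · have : (fun x : (∀ j, T j) × T i => Function.update x.1 i x.2) ⁻¹' (s : Set κ).pi t =
        ((s.erase i : Finset κ) : Set κ).pi t ×ˢ t i := by
      ext x
      simp only [Set.mem_preimage, Set.mem_pi, Set.mem_prod, Finset.mem_coe, Finset.mem_erase]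
      constructor
      · intro h
        refine ⟨fun j hj => ?_, by simpa using h i hi⟩
        simpa [Function.update_of_ne hj.1] using h j hj.2
      · rintro ⟨h, h'⟩ j hj
        by_cases hji : j = i
        · subst hji
          simpa using h'
        · simpa [Function.update_of_ne hji] using h j ⟨hji, hj⟩
    rw [this, Measure.prod_prod, Measure.infinitePi_pi _ fun j _ => ht j,
      Finset.prod_erase_mul _ _ hi]
  · have : (fun x : (∀ j, T j) × T i => Function.update x.1 i x.2) ⁻¹' (s : Set κ).pi t =
        (s : Set κ).pi t ×ˢ Set.univ := by
      ext x
      simp only [Set.mem_preimage, Set.mem_pi, Set.mem_prod, Finset.mem_coe, Set.mem_univ, and_true]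
      refine forall₂_congr fun j hj => ?_
      rw [Function.update_of_ne (by rintro rfl; exact hi hj)]
    rw [this, Measure.prod_prod, Measure.infinitePi_pi _ fun j _ => ht j, measure_univ, mul_one]

variable {κ T E : Type*} [LinearOrder κ] [MeasurableSpace T] [MeasurableSpace E]

/-- The probability that the coordinate `i` of the random Boolean family `X` is `true`,
conditionally on the coordinates below `i`. -/
noncomputable def predictor (ν : Measure E) (X : E → κ → Bool) (i : κ) : (κ → Bool) → ℝ≥0∞ :=
  ((ν.restrict {e | X e i = true}).map fun e => truncBelow i (X e)).rnDeriv
    (ν.map fun e => truncBelow i (X e))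

variable {ν : Measure E} {X : E → κ → Bool}

theorem map_restrict_le (hX : Measurable X) (i : κ) :
    ((ν.restrict {e | X e i = true}).map fun e => truncBelow i (X e)) ≤
      ν.map fun e => truncBelow i (X e) :=
  Measure.map_mono Measure.restrict_le_self ((measurable_truncBelow i).comp hX)

variable [IsProbabilityMeasure ν]

theorem setLIntegral_predictor (hX : Measurable X) (i : κ) (S : Set (κ → Bool)) :
    ∫⁻ y in S, predictor ν X i y ∂(ν.map fun e => truncBelow i (X e)) =
      ((ν.restrict {e | X e i = true}).map fun e => truncBelow i (X e)) S := 
  Measure.setLIntegral_rnDeriv (Measure.absolutelyContinuous_of_le (map_restrict_le hX i)) S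

/-- A density of a dominated measure is at most one almost everywhere. Sources are only required to
realize parameters `q ≤ 1`. -/
theorem predictor_le_one (hX : Measurable X) (i : κ) :
    ∀ᵐ y ∂(ν.map fun e => truncBelow i (X e)), predictor ν X i y ≤ 1 := by
  have : IsProbabilityMeasure (ν.map fun e => truncBelow i (X e)) :=
    Measure.isProbabilityMeasure_map ((measurable_truncBelow i).comp hX).aemeasurable
  refine ae_le_of_forall_setLIntegral_le_of_sigmaFinite (Measure.measurable_rnDeriv _ _)
    fun S hS _ => ?_
  rw [setLIntegral_predictor hX, setLIntegral_one]
  exact map_restrict_le hX i S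

variable [WellFoundedLT κ]

/-- The entry `i` of a sequential sample uses a source independent of the entries below `i`. -/
theorem map_truncBelow_sequentialSample_prodMk {p : κ → (κ → Bool) → ℝ≥0∞}
    {D : Set (ℝ≥0∞ × T)} (hp : ∀ i, Measurable (p i)) (hD : MeasurableSet D)
    (τ : Measure T) [IsProbabilityMeasure τ] (i : κ) :
    (Measure.infinitePi fun _ : κ => τ).map
        (fun ω => (truncBelow i (sequentialSample p D ω), ω i)) =
      ((Measure.infinitePi fun _ : κ => τ).map
        fun ω => truncBelow i (sequentialSample p D ω)).prod τ := by
  have hφ : Measurable fun ω : κ → T => truncBelow i (sequentialSample p D ω) :=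
    (measurable_truncBelow i).comp (measurable_sequentialSample hp hD)
  -- With coordinate `i` resampled, the entries below `i` depend on the old point alone and the
  -- source at `i` is the fresh value.
  conv_lhs => rw [← infinitePi_map_update (fun _ : κ => τ) i]
  rw [Measure.map_map (hφ.prodMk (measurable_pi_apply i)) (measurable_update_prod i)]
  have := Measure.map_prod_map (Measure.infinitePi fun _ : κ => τ) τ hφ measurable_id
  rw [Measure.map_id] at this
  rw [this]
  congr 1
  funext x
  refine Prod.ext (truncBelow_congr fun j hj => ?_) (by simp)
  exact sequentialSample_update _ _ _ _ hj

/-- By Fubini, a history `y` yields `true` at `i` with probability `predictor ν X i y`; integrating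
over `S` recovers the measure whose density the predictor is. -/
theorem measure_sequentialSample_step {D : Set (ℝ≥0∞ × T)} (hX : Measurable X)
    (hD : MeasurableSet D) {τ : Measure T} [IsProbabilityMeasure τ]
    (hτ : ∀ q ≤ 1, τ {t | (q, t) ∈ D} = q) {i : κ}
    (hi : ((Measure.infinitePi fun _ : κ => τ).map
      fun ω => truncBelow i (sequentialSample (predictor ν X) D ω)) =
        ν.map fun e => truncBelow i (X e))
    {S : Set (κ → Bool)} (hS : MeasurableSet S) :
    (Measure.infinitePi fun _ : κ => τ)
        {ω | truncBelow i (sequentialSample (predictor ν X) D ω) ∈ S ∧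
          sequentialSample (predictor ν X) D ω i = true} =
      ν {e | truncBelow i (X e) ∈ S ∧ X e i = true} := by
  have hp : ∀ i, Measurable (predictor ν X i) := fun i => Measure.measurable_rnDeriv _ _
  have hX' : Measurable fun e => truncBelow i (X e) := (measurable_truncBelow i).comp hX
  have hφ : Measurable fun ω : κ → T => truncBelow i (sequentialSample (predictor ν X) D ω) :=
    (measurable_truncBelow i).comp (measurable_sequentialSample hp hD)
  let A : Set ((κ → Bool) × T) := {x | x.1 ∈ S ∧ (predictor ν X i x.1, x.2) ∈ D}
  have hA : MeasurableSet A :=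
    (measurable_fst hS).inter ((((hp i).comp measurable_fst).prodMk measurable_snd) hD)
  have h1 : {ω | truncBelow i (sequentialSample (predictor ν X) D ω) ∈ S ∧
      sequentialSample (predictor ν X) D ω i = true} =
      (fun ω => (truncBelow i (sequentialSample (predictor ν X) D ω), ω i)) ⁻¹' A := by
    ext ω
    simp [A, sequentialSample_eq_true_iff]
  have hXi : MeasurableSet {e | X e i = true} :=
    ((measurable_pi_apply i).comp hX) (measurableSet_singleton true)
  have h2 : {e | truncBelow i (X e) ∈ S ∧ X e i = true} =
      (fun e => truncBelow i (X e)) ⁻¹' S ∩ {e | X e i = true} := rfl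
  rw [h1, ← Measure.map_apply (hφ.prodMk (measurable_pi_apply i)) hA,
    map_truncBelow_sequentialSample_prodMk hp hD τ i, hi, Measure.prod_apply hA, h2,
    ← Measure.restrict_apply (hX' hS),
    ← Measure.map_apply hX' hS,
    ← setLIntegral_predictor hX, ← lintegral_indicator hS]
  refine lintegral_congr_ae ?_
  filter_upwards [predictor_le_one hX i] with y hy
  by_cases hyS : y ∈ S
  · have : Prod.mk y ⁻¹' A = {t | (predictor ν X i y, t) ∈ D} := by
      ext t
      simp [A, hyS]
    rw [this, hτ _ hy, Set.indicator_of_mem hyS]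
  · have : Prod.mk y ⁻¹' A = ∅ := by
      ext t
      simp [A, hyS]
    rw [this, measure_empty, Set.indicator_of_notMem hyS]

theorem measure_sequentialSample_cylinder {D : Set (ℝ≥0∞ × T)} (hX : Measurable X)
    (hD : MeasurableSet D) {τ : Measure T} [IsProbabilityMeasure τ]
    (hτ : ∀ q ≤ 1, τ {t | (q, t) ∈ D} = q) {i : κ}
    (hi : ((Measure.infinitePi fun _ : κ => τ).map
      fun ω => truncBelow i (sequentialSample (predictor ν X) D ω)) =
        ν.map fun e => truncBelow i (X e))
    {F : Finset κ} (hiF : i ∈ F) (hmax : ∀ j ∈ F, j ≤ i) :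
    (Measure.infinitePi fun _ : κ => τ)
        {ω | ∀ j ∈ F, sequentialSample (predictor ν X) D ω j = true} =
      ν {e | ∀ j ∈ F, X e j = true} := by
  simp_rw [forall_mem_iff_truncBelow hiF hmax]
  exact measure_sequentialSample_step hX hD hτ hi (measurableSet_forall_mem_eq_true _)

/-- Well-founded induction without a limit case: a nonempty finite set of indices below `i` has a
greatest element, where the induction hypothesis and one sampling step apply. -/
theorem map_truncBelow_sequentialSample {D : Set (ℝ≥0∞ × T)} (hX : Measurable X)
    (hD : MeasurableSet D) {τ : Measure T} [IsProbabilityMeasure τ]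
    (hτ : ∀ q ≤ 1, τ {t | (q, t) ∈ D} = q) (i : κ) :
    ((Measure.infinitePi fun _ : κ => τ).map
      fun ω => truncBelow i (sequentialSample (predictor ν X) D ω)) =
        ν.map fun e => truncBelow i (X e) := by
  have hp : ∀ i, Measurable (predictor ν X i) := fun i => Measure.measurable_rnDeriv _ _
  induction i using WellFoundedLT.induction with
  | ind i ih =>
    have hX' : Measurable fun e => truncBelow i (X e) := (measurable_truncBelow i).comp hX
    have hφ : Measurable fun ω : κ → T => truncBelow i (sequentialSample (predictor ν X) D ω) :=
      (measurable_truncBelow i).comp (measurable_sequentialSample hp hD)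
    refine measure_bool_pi_ext fun F => ?_
    have hF := measurableSet_forall_mem_eq_true F
    rw [Measure.map_apply hφ hF, Measure.map_apply hX' hF]
    simp only [Set.preimage_ofPred_eq]
    by_cases hFi : ∀ j ∈ F, j < i
    · have h (y : κ → Bool) : (∀ j ∈ F, truncBelow i y j = true) ↔ ∀ j ∈ F, y j = true :=
        forall₂_congr fun j hj => by rw [truncBelow, if_pos (hFi j hj)]
      simp_rw [h]
      rcases F.eq_empty_or_nonempty with rfl | hne
      · simp
      · exact measure_sequentialSample_cylinder hX hD hτ (ih _ (hFi _ (F.max'_mem hne)))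
          (F.max'_mem hne) fun j hj => F.le_max' j hj
    -- Truncation puts `false` at every index not below `i`, so both cylinders are empty.
    · push Not at hFi
      obtain ⟨j, hj, hij⟩ := hFi
      have h (y : κ → Bool) : ¬ ∀ j ∈ F, truncBelow i y j = true := fun h => by
        simpa [truncBelow, hij.not_gt] using h j hj
      simp [h]

/-- Every law on `2^κ` is the image of a power of `τ`, provided `τ` can sample Boolean variables
of any given probability. -/
theorem map_sequentialSample {D : Set (ℝ≥0∞ × T)} (hX : Measurable X)
    (hD : MeasurableSet D) {τ : Measure T} [IsProbabilityMeasure τ]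
    (hτ : ∀ q ≤ 1, τ {t | (q, t) ∈ D} = q) :
    ((Measure.infinitePi fun _ : κ => τ).map (sequentialSample (predictor ν X) D)) = ν.map X := by
  have hp : ∀ i, Measurable (predictor ν X i) := fun i => Measure.measurable_rnDeriv _ _
  have hφ : Measurable (sequentialSample (predictor ν X) D : (κ → T) → κ → Bool) :=
    measurable_sequentialSample hp hD
  have := Measure.isProbabilityMeasure_map (μ := Measure.infinitePi fun _ : κ => τ) hφ.aemeasurable
  refine measure_bool_pi_ext fun F => ?_
  have hF := measurableSet_forall_mem_eq_true F
  rw [Measure.map_apply hφ hF, Measure.map_apply hX hF]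
  rcases F.eq_empty_or_nonempty with rfl | hne
  · simp
  · exact measure_sequentialSample_cylinder hX hD hτ
      (map_truncBelow_sequentialSample hX hD hτ _)
      (F.max'_mem hne) fun j hj => F.le_max' j hj

end Laws

/-! ### Realizing arbitrary probabilities by fair coins. -/

theorem coinMeasure_singleton (b : Bool) : coinMeasure {b} = 2⁻¹ := by
  rw [coinMeasure, PMF.toMeasure_apply_singleton _ _ (measurableSet_singleton b)]
  simp

/-- The sequences of coin tosses whose first `true` is at position `n`. -/
def firstTrueAt (n : ℕ) : Set (ℕ → Bool) := {x | x n = true ∧ ∀ k < n, x k = false}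

theorem firstTrueAt_eq_pi (n : ℕ) :
    firstTrueAt n = ((Finset.range (n + 1) : Finset ℕ) : Set ℕ).pi fun k => {decide (k = n)} := by
  ext x
  simp only [firstTrueAt, Set.mem_ofPred_eq, Set.mem_pi, Finset.coe_range, Set.mem_Iio,
    Set.mem_singleton_iff, Nat.lt_succ_iff]
  constructor
  · rintro ⟨h, h'⟩ k hk
    rcases hk.eq_or_lt with rfl | hk
    · simpa using h
    · simpa [hk.ne] using h' k hk
  · intro h
    exact ⟨by simpa using h n le_rfl, fun k hk => by simpa [hk.ne] using h k hk.le⟩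

theorem measurableSet_firstTrueAt (n : ℕ) : MeasurableSet (firstTrueAt n) := by
  rw [firstTrueAt_eq_pi]
  exact .pi (Finset.countable_toSet _) fun _ _ => measurableSet_singleton _

theorem cantorMeasure_firstTrueAt (n : ℕ) : cantorMeasure ℕ (firstTrueAt n) = 2⁻¹ ^ (n + 1) := by
  rw [firstTrueAt_eq_pi, cantorMeasure,
    Measure.infinitePi_pi _ fun _ _ => measurableSet_singleton _]
  simp [coinMeasure_singleton]

theorem pairwise_disjoint_firstTrueAt : Pairwise (Function.onFun Disjoint firstTrueAt) := by
  intro m n hmn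
  refine Set.disjoint_left.2 fun x hm hn => ?_
  rcases hmn.lt_or_gt with h | h
  · exact Bool.false_ne_true ((hn.2 _ h).symm.trans hm.1)
  · exact Bool.false_ne_true ((hm.2 _ h).symm.trans hn.1)

/-- Pairs `(q, x)` such that the binary digit of `q` at the position of the first `true` in `x`
is `1`, together with all pairs with `q = 1`. -/
def binarySampler : Set (ℝ≥0∞ × (ℕ → Bool)) :=
  {z | z.1 = 1} ∪ ⋃ n, {q | q < 1 ∧ Real.digits q.toReal 2 n = 1} ×ˢ firstTrueAt n

theorem measurableSet_binarySampler : MeasurableSet binarySampler := by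
  refine (measurable_fst (measurableSet_singleton 1)).union
    (.iUnion fun n => .prod (measurableSet_Iio.inter ?_) (measurableSet_firstTrueAt n))
  have h : Measurable fun q : ℝ≥0∞ => ⌊q.toReal * ((2 : ℕ) : ℝ) ^ (n + 1)⌋₊ :=
    Nat.measurable_floor.comp (ENNReal.measurable_toReal.mul_const _)
  exact (measurable_from_top (f := fun k : ℕ => Fin.ofNat 2 k)).comp h (measurableSet_singleton 1)

/-- The first `true` is at `n` with probability `2⁻¹ ^ (n + 1)`, the weight of the binary digit `n`,
counted from zero; summing over the digits equal to `1` gives `q`. -/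
theorem cantorMeasure_binarySampler (q : ℝ≥0∞) (hq : q ≤ 1) :
    cantorMeasure ℕ {x | (q, x) ∈ binarySampler} = q := by
  have : IsProbabilityMeasure (cantorMeasure ℕ) := by unfold cantorMeasure; infer_instance
  rcases hq.eq_or_lt with rfl | hq
  · simp [binarySampler]
  have hset : {x | (q, x) ∈ binarySampler} =
      ⋃ n, {x | x ∈ firstTrueAt n ∧ Real.digits q.toReal 2 n = 1} := by
    ext x
    simp [binarySampler, hq, hq.ne, and_comm]
  have hq1 : q.toReal ∈ Set.Ico (0 : ℝ) 1 :=
    ⟨ENNReal.toReal_nonneg, by simpa using (ENNReal.toReal_lt_toReal hq.ne_top (by simp)).2 hq⟩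
  have hsum := Real.hasSum_ofDigitsTerm_digits q.toReal (b := 2) one_lt_two hq1
  have hmeas (n : ℕ) :
      MeasurableSet {x | x ∈ firstTrueAt n ∧ Real.digits q.toReal 2 n = 1} :=
    (measurableSet_firstTrueAt n).inter (.const _)
  rw [hset, measure_iUnion
    (fun m n hmn => (pairwise_disjoint_firstTrueAt hmn).mono (fun _ h => h.1) fun _ h => h.1)
    hmeas]
  have hterm (n : ℕ) : cantorMeasure ℕ {x | x ∈ firstTrueAt n ∧ Real.digits q.toReal 2 n = 1} =
      ENNReal.ofReal (Real.ofDigitsTerm (Real.digits q.toReal 2) n) := by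
    rw [Real.ofDigitsTerm]
    rcases Fin.exists_fin_two.1 ⟨Real.digits q.toReal 2 n, rfl⟩ with h | h
    · simp [h]
    · simp only [h, and_true, Set.ofPred_mem_eq, cantorMeasure_firstTrueAt]
      rw [Fin.val_one, Nat.cast_one, one_mul, ENNReal.ofReal_inv_of_pos (by positivity),
        ENNReal.ofReal_pow (by positivity), ENNReal.inv_pow]
      simp
  simp_rw [hterm]
  rw [← ENNReal.ofReal_tsum_of_nonneg (fun n => Real.ofDigitsTerm_nonneg) hsum.summable,
    hsum.tsum_eq, ENNReal.ofReal_toReal hq.ne_top]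

/-- If `ι` is equipotent with `κ × ℕ`, every law on `2^κ` is an image of the fair coin measure
on `2^ι`. -/
theorem exists_map_cantorMeasure_eq {ι κ E : Type*} [MeasurableSpace E] (e : ι ≃ κ × ℕ)
    (ν : Measure E) [IsProbabilityMeasure ν] {X : E → κ → Bool} (hX : Measurable X) :
    ∃ Ψ : (ι → Bool) → κ → Bool, Measurable Ψ ∧ (cantorMeasure ι).map Ψ = ν.map X := by
  -- Any well-order can drive the sampling; the law obtained does not depend on it.
  obtain ⟨_, _⟩ := exists_wellFoundedLT κ
  have : IsProbabilityMeasure (cantorMeasure ℕ) := by unfold cantorMeasure; infer_instance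
  have hφ : Measurable
      (sequentialSample (predictor ν X) binarySampler : (κ → ℕ → Bool) → κ → Bool) :=
    measurable_sequentialSample (fun i => Measure.measurable_rnDeriv _ _)
      measurableSet_binarySampler
  refine ⟨sequentialSample (predictor ν X) binarySampler ∘ MeasurableEquiv.curry κ ℕ Bool ∘
    MeasurableEquiv.piCongrLeft (fun _ => Bool) e,
    hφ.comp ((MeasurableEquiv.measurable _).comp (MeasurableEquiv.measurable _)), ?_⟩
  rw [← Measure.map_map hφ ((MeasurableEquiv.measurable _).comp (MeasurableEquiv.measurable _)),
    ← Measure.map_map (MeasurableEquiv.measurable _) (MeasurableEquiv.measurable _), cantorMeasure,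
    Measure.infinitePi_map_piCongrLeft (fun _ : κ × ℕ => coinMeasure) e,
    Measure.infinitePi_map_curry (fun (_ : κ) (_ : ℕ) => coinMeasure)]
  exact map_sequentialSample hX measurableSet_binarySampler cantorMeasure_binarySampler

-- Covering numbers, compactness and separability.

universe u in
/-- Fewer than `cov` many null sets do not cover the space. -/
theorem exists_forall_notMem_of_lt_coveringNumber {X J : Type u} [MeasurableSpace X]
    {μ : Measure X} (h : #J < coveringNumber (nullIdeal μ)) (N : J → Set X)
    (hN : ∀ j, μ (N j) = 0) : ∃ x, ∀ j, x ∉ N j := by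
  by_contra! hx
  refine h.not_ge (le_trans (csInf_le' ⟨Set.range N, ?_, ?_, rfl⟩) mk_range_le)
  · rintro _ ⟨j, rfl⟩
    exact hN j
  · refine Set.eq_univ_of_forall fun x => ?_
    obtain ⟨j, hj⟩ := hx x
    exact ⟨N j, ⟨j, rfl⟩, hj⟩

theorem exists_isPiBase_mk_eq_piWeight (K : Type*) [TopologicalSpace K] :
    ∃ P : Set (Set K), IsPiBase P ∧ #P = piWeight K := by
  refine csInf_mem (s := {κ | ∃ P : Set (Set K), IsPiBase P ∧ #P = κ})
    ⟨_, {U | IsOpen U ∧ U.Nonempty}, ⟨fun _ h => h.1, fun _ h => h.2,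
      fun V hV hne => ⟨V, ⟨hV, hne⟩, subset_rfl⟩⟩, rfl⟩

theorem separableSpace_of_forall_exists_mem {K ι : Type*} [TopologicalSpace K]
    {P : Set (Set K)} (hP : IsPiBase P) {U : ι → Set K} (hU : P ⊆ Set.range U) (x : ℕ → K)
    (hx : ∀ i, ∃ n, x n ∈ U i) : TopologicalSpace.SeparableSpace K := by
  refine ⟨Set.range x, Set.countable_range x, dense_iff_inter_open.2 fun V hV hne => ?_⟩
  obtain ⟨W, hW, hWV⟩ := hP.exists_subset V hV hne
  obtain ⟨i, rfl⟩ := hU hW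
  obtain ⟨n, hn⟩ := hx i
  exact ⟨x n, hWV hn, n, rfl⟩

theorem exists_forall_mem_of_compact {K ι : Type*} [TopologicalSpace K] [CompactSpace K]
    {b : ι → Set K} (hb : ∀ i, IsClosed (b i)) {C : Set ι}
    (hC : ∀ F : Finset ι, (∀ i ∈ F, i ∈ C) → (⋂ i ∈ F, b i).Nonempty) :
    ∃ x, ∀ i ∈ C, x ∈ b i := by
  classical
  have : (⋂ i : C, b i).Nonempty := by
    refine CompactSpace.iInter_nonempty (fun i => hb i) fun s => ?_
    obtain ⟨x, hx⟩ := hC (s.image Subtype.val) (by simp +contextual)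
    refine ⟨x, Set.mem_iInter₂.2 fun i hi => ?_⟩
    exact Set.mem_iInter₂.1 hx i (Finset.mem_image_of_mem _ hi)
  obtain ⟨x, hx⟩ := this
  exact ⟨x, fun i hi => Set.mem_iInter.1 hx ⟨i, hi⟩⟩

/-- A random sequence of points almost surely enters a given set of positive measure. -/
theorem infinitePi_forall_notMem_eq_zero {K : Type*} [MeasurableSpace K] (μ : Measure K)
    [IsProbabilityMeasure μ] {B : Set K} (hB : MeasurableSet B) (hpos : 0 < μ B) :
    (Measure.infinitePi fun _ : ℕ => μ) {x | ∀ n, x n ∉ B} = 0 := by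
  have hlt : μ Bᶜ < 1 := by
    rw [prob_compl_eq_one_sub hB]
    exact ENNReal.sub_lt_self (by simp) (by simp) hpos.ne'
  refine le_antisymm (ge_of_tendsto' (ENNReal.tendsto_pow_atTop_nhds_zero_of_lt_one hlt)
    fun n => ?_) bot_le
  calc (Measure.infinitePi fun _ : ℕ => μ) {x | ∀ n, x n ∉ B}
      ≤ (Measure.infinitePi fun _ : ℕ => μ)
          ((Finset.range n : Set ℕ).pi fun _ => Bᶜ) := measure_mono fun x hx k _ => hx k
    _ = μ Bᶜ ^ n := by
        rw [Measure.infinitePi_pi _ fun _ _ => hB.compl]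
        simp

/-- If `#ι < cov(𝒩_ι)`, then some sequence of points meets each set of a given family, indexed by
`ι`, of closed sets of positive measure. -/
theorem exists_seq_forall_exists_mem {ι : Type} [Infinite ι]
    (hcov : #ι < coveringNumber (nullIdeal (cantorMeasure ι))) {K : Type*} [TopologicalSpace K]
    [CompactSpace K] [MeasurableSpace K] [BorelSpace K] (μ : Measure K) [IsProbabilityMeasure μ]
    {b : ι → Set K} (hb : ∀ i, IsClosed (b i)) (hpos : ∀ i, 0 < μ (b i)) :
    ∃ x : ℕ → K, ∀ i, ∃ n, x n ∈ b i := by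
  classical
  have hι : ℵ₀ ≤ #ι := aleph0_le_mk ι
  -- Every entry `(n, i)` of the pattern gets its own infinite sequence of coin tosses.
  obtain ⟨e⟩ : Nonempty (ι ≃ (ℕ × ι) × ℕ) := Cardinal.eq.1 <| by
    simp [aleph0_mul_eq hι, mul_aleph0_eq hι]
  let X : (ℕ → K) → ℕ × ι → Bool := fun x q => decide (x q.1 ∈ b q.2)
  have hX : Measurable X := by
    refine measurable_pi_lambda _ fun q => measurable_to_bool ?_
    have : (fun x => X x q) ⁻¹' {true} = (fun x : ℕ → K => x q.1) ⁻¹' b q.2 := by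
      ext x
      simp [X]
    rw [this]
    exact measurable_pi_apply q.1 (hb q.2).measurableSet
  obtain ⟨Ψ, hΨ, hmap⟩ := exists_map_cantorMeasure_eq e (Measure.infinitePi fun _ : ℕ => μ) hX
  have hnull {S : Set (ℕ × ι → Bool)} (hS : MeasurableSet S) :
      cantorMeasure ι (Ψ ⁻¹' S) = (Measure.infinitePi fun _ : ℕ => μ) (X ⁻¹' S) := by
    rw [← Measure.map_apply hΨ hS, hmap, Measure.map_apply hX hS]
  let miss : ι → Set (ℕ × ι → Bool) := fun i => {y | ∀ n, y (n, i) = false}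
  -- Patterns asking the point `q.1` to lie in finitely many sets with empty intersection. Finite
  -- subsets suffice for compactness, and there are only `#ι` of them.
  let meet : ℕ × Finset ι → Set (ℕ × ι → Bool) := fun q =>
    {y | (∀ i ∈ q.2, y (q.1, i) = true) ∧ ⋂ i ∈ q.2, b i = ∅}
  have hmiss (i : ι) : cantorMeasure ι (Ψ ⁻¹' miss i) = 0 := by
    have hm : MeasurableSet (miss i) := by
      have : miss i = ⋂ n, (fun y => y (n, i)) ⁻¹' {false} := by
        ext y
        simp [miss]
      rw [this]
      exact .iInter fun n => measurable_pi_apply (n, i) (measurableSet_singleton false)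
    rw [hnull hm]
    convert infinitePi_forall_notMem_eq_zero μ (hb i).measurableSet (hpos i) using 2
    ext x
    simp [miss, X]
  have hmeet (q : ℕ × Finset ι) : cantorMeasure ι (Ψ ⁻¹' meet q) = 0 := by
    have hm : MeasurableSet (meet q) := by
      refine MeasurableSet.inter ?_ (.const _)
      have h := measurableSet_forall_mem_eq_true (q.2.image (Prod.mk q.1))
      simp only [Finset.forall_mem_image] at h
      exact h
    rw [hnull hm]
    -- No actual sequence has such a pattern. A value of `Ψ` need not be the pattern of a sequence,
    -- so these sets must still be avoided.
    convert measure_empty (μ := Measure.infinitePi fun _ : ℕ => μ)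
    refine Set.eq_empty_of_forall_notMem fun x hx => ?_
    have : x q.1 ∈ ⋂ i ∈ q.2, b i := Set.mem_iInter₂.2 fun i hi => by simpa [X] using hx.1 i hi
    rw [hx.2] at this
    exact this
  have hcard : #(ι ⊕ ℕ × Finset ι) = #ι := by
    simp [mk_finset_of_infinite, aleph0_mul_eq hι, add_eq_self hι]
  obtain ⟨z, hz⟩ := exists_forall_notMem_of_lt_coveringNumber (hcard.trans_lt hcov)
    (Sum.elim (fun i => Ψ ⁻¹' miss i) fun q => Ψ ⁻¹' meet q)
    (by rintro (i | q); exacts [hmiss i, hmeet q])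
  have hex (n : ℕ) : ∃ x, ∀ i ∈ {i | Ψ z (n, i) = true}, x ∈ b i := by
    refine exists_forall_mem_of_compact hb fun F hF => ?_
    rw [Set.nonempty_iff_ne_empty]
    exact fun h => hz (.inr (n, F)) ⟨hF, h⟩
  choose x hx using hex
  refine ⟨x, fun i => ?_⟩
  have hi : ¬ ∀ n, Ψ z (n, i) = false := hz (.inl i)
  push Not at hi
  obtain ⟨n, hn⟩ := hi
  exact ⟨n, hx n i (by simpa using hn)⟩

theorem theorem4p4
    (hcov : (ℵ₁ : Cardinal.{0}) < coveringNumber (cantorNullIdeal (ℵ₁ : Cardinal.{0})))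
    {K : Type*} [TopologicalSpace K] [CompactSpace K] [T2Space K]
    (hK : SupportsMeasure K) (hπ : piWeight K ≤ ℵ₁) :
    TopologicalSpace.SeparableSpace K := by
  rcases isEmpty_or_nonempty K with _ | _
  · infer_instance
  obtain ⟨_, _, μ, _, -, _⟩ := hK
  obtain ⟨P, hP, hPcard⟩ := exists_isPiBase_mk_eq_piWeight K
  let ι : Type := (ℵ₁ : Cardinal.{0}).out
  have hι : #ι = ℵ₁ := mk_out _
  have : Infinite ι := infinite_iff.2 (hι ▸ aleph0_le_aleph 1)
  obtain ⟨W, hW, -⟩ := hP.exists_subset Set.univ isOpen_univ Set.univ_nonempty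
  have : Nonempty P := ⟨⟨W, hW⟩⟩
  obtain ⟨f⟩ : Nonempty (P ↪ ι) := lift_mk_le'.1 <| by
    rw [hι, hPcard]
    simpa using hπ
  let U : ι → Set K := fun i => (Function.invFun f i : P)
  have hU : P ⊆ Set.range U := fun V hV =>
    ⟨f ⟨V, hV⟩, by simp [U, Function.leftInverse_invFun f.injective _]⟩
  have hshrink (i : ι) : ∃ b : Set K, IsClosed b ∧ b ⊆ U i ∧ 0 < μ b := by
    have hUP : U i ∈ P := (Function.invFun f i : P).2
    obtain ⟨x, hx⟩ := hP.nonempty _ hUP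
    -- Closedness is needed to realize patterns by compactness; being a neighbourhood keeps the
    -- measure positive.
    obtain ⟨t, ht, htc, htU⟩ := exists_mem_nhds_isClosed_subset ((hP.isOpen _ hUP).mem_nhds hx)
    exact ⟨t, htc, htU, μ.measure_pos_of_mem_nhds ht⟩
  choose b hbc hbU hpos using hshrink
  have : IsProbabilityMeasure ((μ Set.univ)⁻¹ • μ) := isProbabilityMeasureSMul
  obtain ⟨x, hx⟩ := exists_seq_forall_exists_mem (hι.trans_lt hcov) ((μ Set.univ)⁻¹ • μ) hbc
    fun i => by
      exact ENNReal.mul_pos (ENNReal.inv_ne_zero.2 (measure_ne_top _ _)) (hpos i).ne'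
  exact separableSpace_of_forall_exists_mem hP hU x fun i => (hx i).imp fun n hn => hbU i hn
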